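/- Let $\mathbb F_q$ be a finite field with $q$ elements, $n\ge 0$ an integer, and $P=\sum_{i=0}^m a_i\theta^i\in\mathbb F_q[\theta]$ a nonzero polynomial of degree $m$; put $a_i=0$ for $i\notin\{0,\dots,m\}$. Let $\mathfrak C^n_P$ be the $P$-twist of the $n$-th tensor power of the Carlitz module: the free $\mathbb F_q(\theta)[T]$-module of rank one with basis $e$, with the additive map $\tau$ that satisfies $\tau(\theta x)=\theta^q\tau(x)$, $\tau(Tx)=T\tau(x)$ and $\tau(e)=Q\,e$, where $Q=P\,(T-\theta)^n$. For a monic irreducible $\mathfrak P\in\mathbb F_q[\theta]$ of degree $d$, let $\tilde Q\in(\mathbb F_q[\theta]/\mathfrak P)[T]$ be the reduction of $Q$ modulo $\mathfrak P$, and put $\tilde Q^{[d]}=\tilde Q^{(d-1)}\cdots\tilde Q^{(1)}\tilde Q$, where $(\sum_i c_iT^i)^{(s)}=\sum_i c_i^{q^s}T^i$. Then $\tilde Q^{[d]}\in\mathbb F_q[T]$. Let $$L(\mathfrak C^n_P,U)=\prod_{\mathfrak P}\bigl(1-\tilde Q^{[d]}U^d\bigr)^{-1}\in\mathbb F_q[T][[U]],\qquad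 d=\deg\mathfrak P,$$ the product being over all monic irreducible $\mathfrak P$ ($Q$ is integral at each of them, so there are no bad primes). For $k\ge 0$ let $\mathfrak M(P,n,k)$ be the $k\times k$ matrix over $\mathbb F_q[T]$ with entries $$\mathfrak M(P,n,k)_{i,j}=\sum_{l=0}^n T^{n-l}(-1)^l\binom nl\,a_{iq-j-l},\qquad 1\le i,j\le k.$$ Proposition 3.3. The product defining $L(\mathfrak C^n_P,U)$ converges (coefficientwise in $U$, with $\mathbb F_q[T]$ discrete), and for every integer $k\ge\frac{m+n}{q-1}$ $$L(\mathfrak C^n_P,U)=\det\bigl(I_k-\mathfrak M(P,n,k)\,U\bigr).$$ In particular the right-hand side does not depend on $k$ for $k\ge\frac{m+n}{q-1}$. -/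

import Mathlib

open Polynomial

noncomputable section

namespace TMotive

variable (F : Type*) [Field F] [Fintype F]

/-- The `q`-Frobenius on coefficients, `∑ cᵢ Tⁱ ↦ ∑ cᵢ^q Tⁱ` with `q = #F`, on `A[T]` for a
commutative `F`-algebra `A`. -/
def frob (A : Type*) [CommRing A] [Algebra F A] : A[X] →+* A[X] :=
  mapRingHom (FiniteField.frobeniusAlgHom F A : A →+* A)

/-- The places `𝔓` of `F[θ]`: monic irreducible polynomials. -/
abbrev Place : Type _ := {p : F[X] // p.Monic ∧ Irreducible p}

variable {F}

instance (p : Place F) : Fact (Irreducible p.1) := ⟨p.2.2⟩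

/-- The residue field `F[θ]/𝔓`. -/
abbrev ResidueField (p : Place F) : Type _ := AdjoinRoot p.1

/-- `x ∈ F(θ)` is integer at `𝔓`. -/
def IsIntegerAt (p : Place F) (x : RatFunc F) : Prop := ¬ p.1 ∣ x.denom

/-- Reduction at `𝔓` of an element of `F(θ)` (meaningful when it is integer at `𝔓`). -/
def reduce (p : Place F) (x : RatFunc F) : ResidueField p :=
  AdjoinRoot.mk p.1 x.num / AdjoinRoot.mk p.1 x.denom

/-- Reduction at `𝔓` of the coefficients of an element of `F(θ)[T]`. -/
def reducePoly (p : Place F) (a : (RatFunc F)[X]) : (ResidueField p)[X] :=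
  ∑ i ∈ a.support, monomial i (reduce p (a.coeff i))

section twist

variable {ι : Type*} [Fintype ι] [DecidableEq ι] {A : Type*} [CommRing A] [Algebra F A]

/-- `A^{[k]} = A^{(k-1)} ⋯ A^{(1)} A`, where `A^{(i)}` is the entrywise `i`-th Frobenius twist. -/
def twistProd (F : Type*) [Field F] [Fintype F] [Algebra F A] (Q : Matrix ι ι A[X]) :
    ℕ → Matrix ι ι A[X]
  | 0 => 1
  | k + 1 => Q.map ((frob F A)^[k]) * twistProd F Q k

/-- `det (1 - Q^{[d]} U^d)`, a polynomial in `U` over `A[T]`. -/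
def localDet (F : Type*) [Field F] [Fintype F] [Algebra F A] (Q : Matrix ι ι A[X]) (d : ℕ) :
    A[X][X] :=
  (1 - (X ^ d : A[X][X]) • (twistProd F Q d).map C).det

end twist

section descent

theorem mem_range_of_pow_card_eq {K : Type*} [Field K] [Algebra F K] {x : K}
    (hx : x ^ Fintype.card F = x) : x ∈ Set.range (algebraMap F K) := by
  classical
  have hq : 1 < Fintype.card F := Fintype.one_lt_card
  have hne : (X ^ Fintype.card F - X : K[X]) ≠ 0 := FiniteField.X_pow_card_sub_X_ne_zero K hq
  have hsub : Finset.univ.image (algebraMap F K) ⊆ (X ^ Fintype.card F - X : K[X]).roots.toFinset := by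
    intro y hy
    obtain ⟨c, -, rfl⟩ := Finset.mem_image.1 hy
    rw [Multiset.mem_toFinset, mem_roots hne]
    simp [← map_pow, FiniteField.pow_card]
  have hcard : (X ^ Fintype.card F - X : K[X]).roots.toFinset.card
      ≤ (Finset.univ.image (algebraMap F K)).card := by
    rw [Finset.card_image_of_injective _ (algebraMap F K).injective, Finset.card_univ]
    refine (Multiset.toFinset_card_le _).trans ((card_roots' _).trans ?_)
    rw [FiniteField.X_pow_card_sub_X_natDegree_eq K hq]
  have hmem : x ∈ (X ^ Fintype.card F - X : K[X]).roots.toFinset := by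
    rw [Multiset.mem_toFinset, mem_roots hne]
    simp [hx]
  rw [← Finset.eq_of_subset_of_card_le hsub hcard] at hmem
  obtain ⟨c, -, hc⟩ := Finset.mem_image.1 hmem
  exact ⟨c, hc⟩

theorem frob_iterate {A : Type*} [CommRing A] [Algebra F A] (d : ℕ) (a : A[X]) (i : ℕ) :
    ((frob F A)^[d] a).coeff i = a.coeff i ^ Fintype.card F ^ d := by
  induction d with
  | zero => simp
  | succ d ih =>
    have h (b : A[X]) : (frob F A b).coeff i = b.coeff i ^ Fintype.card F := by simp [frob]
    rw [Function.iterate_succ_apply', h, ih, pow_succ, pow_mul]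

theorem twistProd_map {ι : Type*} [Fintype ι] [DecidableEq ι] {A : Type*} [CommRing A]
    [Algebra F A] (Q : Matrix ι ι A[X]) (k : ℕ) :
    (twistProd F Q k).map (frob F A) * Q = twistProd F Q (k + 1) := by
  induction k with
  | zero => simp [twistProd]
  | succ k ih =>
    rw [twistProd, Matrix.map_mul, Matrix.mul_assoc, ih, Matrix.map_map]
    conv_rhs => rw [twistProd, Function.iterate_succ']

/-- The polynomial `det (1 - Q^{[d]} U^d)` has coefficients in `F[T]` if `Q` has entries in `K[T]`
with `K` of degree `d` over `F`. -/
theorem exists_localDet {ι : Type*} [Fintype ι] [DecidableEq ι] {K : Type*} [Field K] [Algebra F K]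
    (Q : Matrix ι ι K[X]) {d : ℕ} (hd : 0 < d) (hK : ∀ x : K, x ^ Fintype.card F ^ d = x) :
    ∃ h : F[X][X], h.map (mapRingHom (algebraMap F K)) = localDet F Q d := by
  have hfix : (localDet F Q d).map (frob F K) = localDet F Q d := by
    obtain ⟨e, rfl⟩ : ∃ e, d = e + 1 := ⟨d - 1, by omega⟩
    have hQ : Q.map ((frob F K)^[e + 1]) = Q := by
      ext i j n
      rw [Matrix.map_apply, frob_iterate, hK]
    set R := (twistProd F Q e).map (frob F K) with hR
    have h1 : twistProd F Q (e + 1) = R * Q := (twistProd_map Q e).symm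
    have h2 : (twistProd F Q (e + 1)).map (frob F K) = Q * R := by
      rw [twistProd, Matrix.map_mul, Matrix.map_map, ← Function.iterate_succ', hQ]
    have h3 : (localDet F Q (e + 1)).map (frob F K)
        = (1 - (X ^ (e + 1) : K[X][X]) • (Q * R).map C).det := by
      rw [localDet, ← coe_mapRingHom, RingHom.map_det, ← h2]
      congr 1
      ext i j : 2
      by_cases hij : i = j <;>
        simp [RingHom.mapMatrix_apply, Matrix.sub_apply, hij]
    rw [h3, localDet, h1, Matrix.map_mul, Matrix.map_mul, ← Matrix.smul_mul, ← Matrix.mul_smul,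
      Matrix.det_one_sub_mul_comm]
  rw [← mem_lifts, lifts_iff_coeff_lifts]
  intro n
  rw [coe_mapRingHom, ← lifts_iff_set_range, lifts_iff_coeff_lifts]
  intro m
  refine mem_range_of_pow_card_eq ?_
  conv_rhs => rw [← hfix]
  simp [frob, coeff_map]

theorem residueField_pow (p : Place F) (x : ResidueField p) :
    x ^ Fintype.card F ^ p.1.natDegree = x := by
  have hb := (AdjoinRoot.powerBasis p.2.2.ne_zero).finrank
  rw [AdjoinRoot.powerBasis_dim] at hb
  have : Module.Finite F (ResidueField p) := (AdjoinRoot.powerBasis p.2.2.ne_zero).finite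
  have : Finite (ResidueField p) := Module.finite_of_finite F
  have := Fintype.ofFinite (ResidueField p)
  rw [← hb, ← Module.card_eq_pow_finrank, FiniteField.pow_card]

end descent

section LFunction

variable {ι : Type*} [Fintype ι] [DecidableEq ι]

/-- All entries of `Q` are integer at `𝔓`. -/
def IsGoodAt (Q : Matrix ι ι (RatFunc F)[X]) (p : Place F) : Prop :=
  ∀ i j s, IsIntegerAt p ((Q i j).coeff s)

/-- The polynomial `det (1 - Q̃^{[d]} U^d) ∈ F[T][U]`, with `Q̃` the reduction of `Q` at `𝔓` and
`d = deg 𝔓`; it is the only polynomial over `F[T]` whose image over `(F[θ]/𝔓)[T]` is this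
determinant. -/
def localPoly (Q : Matrix ι ι (RatFunc F)[X]) (p : Place F) : F[X][X] :=
  (exists_localDet (Q.map (reducePoly p)) p.2.2.natDegree_pos (residueField_pow p)).choose

/-- The local factor `L_𝔓 = det (1 - Q̃^{[d]} U^d)⁻¹ ∈ F[T][[U]]` (the constant term of the
determinant is `1`). -/
def localFactor (Q : Matrix ι ι (RatFunc F)[X]) (p : Place F) : PowerSeries F[X] :=
  PowerSeries.invOfUnit (localPoly Q p : PowerSeries F[X]) 1

/-- The topology of `F[T][[U]]`: coefficientwise convergence, with `F[T]` discrete. -/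
abbrev seriesTopology (F : Type*) [Field F] : TopologicalSpace (PowerSeries F[X]) :=
  @PowerSeries.WithPiTopology.instTopologicalSpace F[X] ⊥

/-- Convergence of the Euler product over the places at which `Q` is integer. -/
def EulerProductConverges (Q : Matrix ι ι (RatFunc F)[X]) : Prop :=
  letI := seriesTopology F
  Multipliable fun p : {p : Place F // IsGoodAt Q p} => localFactor Q p.1

/-- The `L`-function `∏_𝔓 L_𝔓 ∈ F[T][[U]]`, over the places at which `Q` is integer. -/
def LFunction (Q : Matrix ι ι (RatFunc F)[X]) : PowerSeries F[X] :=
  letI := seriesTopology F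
  ∏' p : {p : Place F // IsGoodAt Q p}, localFactor Q p.1

/-- The matrix `Q` of a Frobenius-semilinear map in a basis `e` of an `F(θ)[T]`-module:
`τ eᵢ = ∑ⱼ Qᵢⱼ eⱼ`. -/
def tauMatrix {M : Type*} [AddCommGroup M] [Module (RatFunc F)[X] M]
    (e : Module.Basis ι (RatFunc F)[X] M) (τ : M →ₛₗ[frob F (RatFunc F)] M) :
    Matrix ι ι (RatFunc F)[X] :=
  Matrix.of fun i j => e.repr (τ (e i)) j

end LFunction

/-- The twist by `P ∈ F[θ]` of the `n`-th tensor power of the Carlitz module: the free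
`F(θ)[T]`-module of rank one `F(θ)[T]·e`, `e = 1`, with the semilinear `τ` such that
`τ e = P (T - θ)^n e`. This is its `τ`. -/
def twistedCarlitzTau (P : F[X]) (n : ℕ) :
    (RatFunc F)[X] →ₛₗ[frob F (RatFunc F)] (RatFunc F)[X] where
  toFun f := frob F (RatFunc F) f * (C (algebraMap F[X] (RatFunc F) P) * (X - C RatFunc.X) ^ n)
  map_add' f g := by rw [map_add, add_mul]
  map_smul' c f := by rw [smul_eq_mul, map_mul, mul_assoc, smul_eq_mul]

/-- The matrix `Q` of the `P`-twist of the `n`-th tensor power of the Carlitz module in the basis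
`e = 1`. -/
def twistedCarlitzMatrix (P : F[X]) (n : ℕ) : Matrix Unit Unit (RatFunc F)[X] :=
  tauMatrix (Module.Basis.singleton Unit (RatFunc F)[X]) (twistedCarlitzTau P n)

/-- The coefficient `a_z` of `P = ∑ aᵢ θⁱ`, with `a_z = 0` for `z < 0`. -/
def coeffInt {F : Type*} [Field F] (P : F[X]) (z : ℤ) : F :=
  if 0 ≤ z then P.coeff z.toNat else 0

/-- The matrix `𝔐(P,n,k)`; rows and columns are numbered from `1` in
`𝔐ᵢⱼ = ∑_{l=0}^n T^{n-l} (-1)^l (n choose l) a_{iq-j-l}`, hence the shifts by one. -/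
def frakM (P : F[X]) (n k : ℕ) : Matrix (Fin k) (Fin k) F[X] :=
  Matrix.of fun i j => ∑ l ∈ Finset.range (n + 1),
    X ^ (n - l) * (-1) ^ l * (n.choose l : F[X]) *
      C (coeffInt P (((i : ℤ) + 1) * Fintype.card F - ((j : ℤ) + 1) - l))

/-- `det (I_k - 𝔐(P,n,k) U) ∈ F[T][U]`. -/
def frakDet (P : F[X]) (n k : ℕ) : F[X][X] :=
  (1 - (X : F[X][X]) • (frakM P n k).map C).det

end TMotive

end

/-!
The idea is that both sides are generating series of sums over monic polynomials. Write
`Q(θ) = P(θ) (T - θ)^n` and, for `f ∈ F[θ]` monic, let `χ(f)` be the product of the values of `Q` at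
the roots of `f`. The roots of an irreducible `𝔓` of degree `d` are the Frobenius conjugates of one
of them (`roots_map_of_irreducible`), so `Q̃^{[d]} = χ(𝔓)`
(`localPoly_twistedCarlitzMatrix_map`). As `χ` is multiplicative, the Euler product converges
coefficientwise to `∑ χ(f) U^{deg f}`: multiplying this series by the factor of a place removes the
multiples of that place (`primeToSeries_mul`), and once all places of degree at most `D` are removed,
what is left is `1` modulo `U^{D+1}` (`coeff_prod_of_mul_eq_one`).

On the other side, `𝔐` is the matrix of `h ↦ ψ(Q h)` in `θ, …, θ^k`, where `ψ` sends `θ^{qi}` to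
`θ^i` and kills the other powers (`frakM_eq_cartierMatrix`). The coefficient of `U^d` in
`det (1 - 𝔐 U)` is `(-1)^d` times the sum of the principal minors of size `d`, which is the trace of
`h ↦ ψ(Q(x₁) ⋯ Q(x_d) h)` on alternating polynomials in `d` variables (`dworkTrace_prodEval`). The
bound on `k` ensures that the monomials `θ^i` with `i > k` contribute nothing.

It remains to see that for every symmetric polynomial `g = G(e₁, …, e_d)` this trace, with `g` in
place of `Q(x₁) ⋯ Q(x_d)`, is `(-1)^d` times the sum of `G` over the points of `F^d`, that is, over
the monic polynomials of degree `d` (`eventually_dworkTrace_esymmEval`). Logarithmic derivatives are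
of no use for this in characteristic `p`, hence the direct comparison for each `d`. Both sides are
unchanged when `e_i^q` is replaced by `e_i`: for the trace this is its cyclicity, since
`ψ(h^q g) = h ψ(g)` (`eventually_dworkTrace_esymm_pow_mul`). This reduces to monomials in the `e_i`
with exponents less than `q`. There both sides vanish, the trace for reasons of degree, unless all
exponents are `q - 1`, and in that case the trace is `1` by comparing lexicographically leading terms
(`dworkTrace_esymmEval_monomial`).
-/

open Polynomial

namespace TMotive

/-! ### The trace of the Cartier operator on alternating polynomials -/

section DworkTrace

variable {d : ℕ}

/-- The strictly decreasing exponent vectors `N ≥ I₀ > I₁ > ⋯ ≥ 1`; they index a basis of the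
alternating polynomials in `d` variables which are divisible by every variable and have degree at
most `N` in each. -/
noncomputable def strictVectors (d N : ℕ) : Finset (Fin d →₀ ℕ) :=
  open Classical in
  {I ∈ Finset.Icc (Finsupp.equivFunOnFinite.symm fun _ => 1)
    (Finsupp.equivFunOnFinite.symm fun _ => N) | StrictAnti I}

theorem mem_strictVectors {N : ℕ} {I : Fin d →₀ ℕ} :
    I ∈ strictVectors d N ↔ (∀ a, 1 ≤ I a) ∧ (∀ a, I a ≤ N) ∧ StrictAnti I := by
  simp [strictVectors, Finsupp.le_def, and_assoc]

variable (R : Type*) [CommRing R]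

/-- The alternant `det (x_a ^ I_b)`. -/
noncomputable def alternant (I : Fin d →₀ ℕ) : MvPolynomial (Fin d) R :=
  (Matrix.of fun a b => MvPolynomial.X a ^ I b).det

variable {R}

theorem alternant_eq_sum_rename (I : Fin d →₀ ℕ) :
    alternant R I = ∑ σ : Equiv.Perm (Fin d), Equiv.Perm.sign σ •
      MvPolynomial.rename σ (MvPolynomial.monomial I 1) := by
  rw [alternant, Matrix.det_apply]
  refine Finset.sum_congr rfl fun σ _ => ?_
  rw [MvPolynomial.monomial_eq, Finsupp.prod_fintype _ _ (by simp)]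
  simp

theorem alternant_eq_zero {I : Fin d →₀ ℕ} {a b : Fin d} (hab : a ≠ b) (h : I a = I b) :
    alternant R I = 0 :=
  Matrix.det_zero_of_column_eq hab fun c => by simp [h]

theorem coeff_alternant_mul (I L : Fin d →₀ ℕ) (g : MvPolynomial (Fin d) R) :
    (alternant R I * g).coeff L = ∑ σ : Equiv.Perm (Fin d), Equiv.Perm.sign σ •
      (MvPolynomial.monomial (I.mapDomain σ) 1 * g).coeff L := by
  rw [alternant_eq_sum_rename, Finset.sum_mul, MvPolynomial.coeff_sum]
  refine Finset.sum_congr rfl fun σ _ => ?_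
  rw [MvPolynomial.rename_monomial, smul_mul_assoc, MvPolynomial.coeff_smul]

/-- A repeated exponent does not occur in an alternating polynomial. In characteristic two the sign
rule says nothing about this, so the terms are cancelled in pairs. -/
theorem coeff_alternant_mul_eq_zero_of_eq {g : MvPolynomial (Fin d) R} (hg : g.IsSymmetric)
    (I : Fin d →₀ ℕ) {L : Fin d →₀ ℕ} {a b : Fin d} (hab : a ≠ b) (h : L a = L b) :
    (alternant R I * g).coeff L = 0 := by
  rw [coeff_alternant_mul]
  have hL : L.mapDomain (Equiv.swap a b) = L := by
    ext c
    rw [← Equiv.apply_symm_apply (Equiv.swap a b) c, Finsupp.mapDomain_apply (Equiv.injective _)]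
    rw [Equiv.apply_symm_apply, Equiv.symm_swap]
    rcases eq_or_ne c a with rfl | hca
    · simp [h]
    rcases eq_or_ne c b with rfl | hcb
    · simp [h]
    · rw [Equiv.swap_apply_of_ne_of_ne hca hcb]
  refine Finset.sum_involution (fun σ _ => Equiv.swap a b * σ) (fun σ _ => ?_) (fun σ _ _ => ?_)
    (fun σ _ => Finset.mem_univ _) (fun σ _ => ?_)
  · have : (MvPolynomial.monomial (I.mapDomain (Equiv.swap a b * σ)) 1 * g).coeff L
        = (MvPolynomial.monomial (I.mapDomain σ) 1 * g).coeff L := by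
      conv_lhs => rw [← hL, ← hg (Equiv.swap a b)]
      rw [Equiv.Perm.coe_mul, Finsupp.mapDomain_comp, ← MvPolynomial.rename_monomial, ← map_mul,
        MvPolynomial.coeff_rename_mapDomain _ (Equiv.injective _)]
    rw [this, Equiv.Perm.sign_mul, Equiv.Perm.sign_swap hab]
    simp
  · rw [Ne, mul_eq_right]
    exact fun h => hab (Equiv.swap_eq_one_iff.1 h)
  · rw [← mul_assoc, Equiv.swap_mul_self, one_mul]

theorem coeff_alternant_mul_eq_zero_of_lt (g : MvPolynomial (Fin d) R) {I L : Fin d →₀ ℕ}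
    {a : Fin d} (h : ∀ b, L a < I b) : (alternant R I * g).coeff L = 0 := by
  rw [coeff_alternant_mul]
  refine Finset.sum_eq_zero fun σ _ => ?_
  rw [MvPolynomial.coeff_monomial_mul', if_neg, smul_zero]
  intro hle
  have := hle a
  rw [← Equiv.apply_symm_apply σ a, Finsupp.mapDomain_apply (Equiv.injective _),
    Equiv.apply_symm_apply] at this
  exact (h _).not_ge this

theorem coeff_alternant_mul_eq_zero_of_degreeOf_lt (g : MvPolynomial (Fin d) R)
    {I L : Fin d →₀ ℕ} {a : Fin d} (h : ∀ b, I b + g.degreeOf a < L a) :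
    (alternant R I * g).coeff L = 0 := by
  rw [coeff_alternant_mul]
  refine Finset.sum_eq_zero fun σ _ => ?_
  rw [MvPolynomial.coeff_monomial_mul']
  split_ifs with hle
  · rw [MvPolynomial.notMem_support_iff.1, mul_zero, smul_zero]
    intro hmem
    have h1 := MvPolynomial.le_degreeOf_of_mem_support a hmem
    have h2 := h (σ.symm a)
    rw [← Finsupp.mapDomain_apply (Equiv.injective σ), Equiv.apply_symm_apply] at h2
    rw [Finsupp.tsub_apply] at h1
    omega
  · rw [smul_zero]

/-- The exponent vector of `∏_{i ∈ s} x_i`. -/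
noncomputable def indicatorVector (s : Finset (Fin d)) : Fin d →₀ ℕ :=
  ∑ i ∈ s, Finsupp.single i 1

theorem indicatorVector_apply (s : Finset (Fin d)) (a : Fin d) :
    indicatorVector s a = if a ∈ s then 1 else 0 := by
  simp [indicatorVector, Finsupp.finsetSum_apply, Finsupp.single_apply]

/-- Pieri's rule for the elementary symmetric polynomials. Vectors `I + 1_s` with repeated components
contribute zero. -/
theorem alternant_mul_esymm (I : Fin d →₀ ℕ) (r : ℕ) :
    alternant R I * MvPolynomial.esymm (Fin d) R r =
      ∑ s ∈ Finset.powersetCard r Finset.univ, alternant R (I + indicatorVector s) := by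
  simp_rw [alternant_eq_sum_rename]
  rw [Finset.sum_comm, Finset.sum_mul]
  refine Finset.sum_congr rfl fun σ _ => ?_
  conv_lhs => rw [← MvPolynomial.esymm_isSymmetric (Fin d) R r σ]
  rw [smul_mul_assoc, ← map_mul, MvPolynomial.esymm_eq_sum_monomial, Finset.mul_sum, map_sum,
    Finset.smul_sum]
  simp only [MvPolynomial.monomial_mul, mul_one, indicatorVector]

theorem esymm_pow_card (F : Type*) [Field F] [Fintype F] [Algebra F R] (r : ℕ) :
    MvPolynomial.esymm (Fin d) R r ^ Fintype.card F =
      ∑ s ∈ Finset.powersetCard r Finset.univ,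
        MvPolynomial.monomial (Fintype.card F • indicatorVector s) 1 := by
  rw [MvPolynomial.esymm_eq_sum_monomial,
    ← FiniteField.frobeniusAlgHom_apply F (MvPolynomial (Fin d) R), map_sum]
  refine Finset.sum_congr rfl fun s _ => ?_
  rw [FiniteField.frobeniusAlgHom_apply, MvPolynomial.monomial_pow, one_pow, indicatorVector]

variable (R) in
/-- The sum of the diagonal entries of `h ↦ ψ(g h)`, for `g` symmetric, in the alternants of
`strictVectors d N`, where `ψ` sends `x^{qI}` to `x^I` and kills the other monomials. The entries
vanish when `I` has large components, so for `N` large this is the trace on all alternating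
polynomials divisible by every variable. -/
noncomputable def dworkTrace (d q N : ℕ) : MvPolynomial (Fin d) R →ₗ[R] R :=
  ∑ I ∈ strictVectors d N, MvPolynomial.lcoeff R (q • I) ∘ₗ LinearMap.mulLeft R (alternant R I)

theorem dworkTrace_apply (q N : ℕ) (g : MvPolynomial (Fin d) R) :
    dworkTrace R d q N g =
      ∑ I ∈ strictVectors d N, (alternant R I * g).coeff (q • I) := by
  simp [dworkTrace, MvPolynomial.lcoeff]

/-- Since `ψ(h^q g) = h ψ(g)`, cyclicity of the trace gives `tr ψ h^q g = tr ψ h g`. -/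
theorem eventually_dworkTrace_esymm_pow_mul (F : Type*) [Field F] [Fintype F] [Algebra F R]
    {g : MvPolynomial (Fin d) R} (hg : g.IsSymmetric) (r : ℕ) :
    ∀ᶠ N in Filter.atTop,
      dworkTrace R d (Fintype.card F) N
        (MvPolynomial.esymm (Fin d) R r ^ Fintype.card F * g) =
      dworkTrace R d (Fintype.card F) N (MvPolynomial.esymm (Fin d) R r * g) := by
  filter_upwards [Filter.eventually_ge_atTop (g.totalDegree + 2)] with N hN
  set q := Fintype.card F with hq
  have hq1 : 2 ≤ q := Fintype.one_lt_card
  simp only [dworkTrace_apply]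
  simp_rw [← mul_assoc, alternant_mul_esymm, hq, esymm_pow_card, ← hq, Finset.mul_sum,
    Finset.sum_mul, MvPolynomial.coeff_sum]
  rw [Finset.sum_comm, Finset.sum_comm (s := strictVectors d N)]
  refine Finset.sum_congr rfl fun s _ => ?_
  have hind (a : Fin d) : indicatorVector s a ≤ 1 := by
    rw [indicatorVector_apply]; split_ifs <;> simp
  have hle {K : Fin d →₀ ℕ} (hK : K ∈ strictVectors d N) : indicatorVector s ≤ K :=
    fun a => (hind a).trans ((mem_strictVectors.1 hK).1 a)
  have hterm {K : Fin d →₀ ℕ} (hK : K ∈ strictVectors d N) :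
      (alternant R K * MvPolynomial.monomial (q • indicatorVector s) 1 * g).coeff (q • K) =
        (alternant R K * g).coeff (q • (K - indicatorVector s)) := by
    have : q • K = q • (K - indicatorVector s) + q • indicatorVector s := by
      rw [← smul_add, tsub_add_cancel_of_le (hle hK)]
    rw [this, mul_right_comm, MvPolynomial.coeff_mul_monomial, mul_one]
  rw [Finset.sum_congr rfl fun K hK => hterm hK]
  -- The diagonal entries of `h ψ g` and `ψ g h` are sums over the same pairs `(K, K - 1_s)`, except
  -- for pairs in which one vector is not strictly decreasing, has a component `0` or exceeds `N`;
  -- the terms of such pairs are zero.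
  refine Finset.sum_bij_ne_zero (fun K _ _ => K - indicatorVector s) ?_ ?_ ?_ ?_
  · intro K hK h0
    obtain ⟨h1, h2, h3⟩ := mem_strictVectors.1 hK
    have hpos : ∀ a, 1 ≤ (K - indicatorVector s) a := by
      intro a
      by_contra! ha
      refine h0 (coeff_alternant_mul_eq_zero_of_lt (a := a) g fun b => ?_)
      rw [Finsupp.smul_apply, Nat.lt_one_iff.1 ha, smul_zero]
      exact h1 b
    refine mem_strictVectors.2 ⟨hpos, fun a => (Nat.sub_le _ _).trans (h2 a), ?_⟩
    intro a b hab
    by_contra! hba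
    refine h0 (coeff_alternant_mul_eq_zero_of_eq hg K hab.ne ?_)
    have := h3 hab
    have hia := hind a
    have hpa := hpos a
    have hpb := hpos b
    simp only [Finsupp.tsub_apply, Finsupp.smul_apply] at *
    congr 1
    omega
  · intro K hK _ K' hK' _ h
    rw [← tsub_add_cancel_of_le (hle hK), h, tsub_add_cancel_of_le (hle hK')]
  · intro I hI h0
    obtain ⟨h1, h2, h3⟩ := mem_strictVectors.1 hI
    have hK : I + indicatorVector s ∈ strictVectors d N := by
      refine mem_strictVectors.2 ⟨fun a => (h1 a).trans (Nat.le_add_right _ _), ?_, ?_⟩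
      · intro a
        by_contra! ha
        refine h0 (coeff_alternant_mul_eq_zero_of_degreeOf_lt (a := a) g fun b => ?_)
        have hia := hind a
        have hib := hind b
        have h2b := h2 b
        have hdeg := g.degreeOf_le_totalDegree a
        simp only [Finsupp.add_apply, Finsupp.smul_apply, smul_eq_mul] at *
        have : 2 * I a ≤ q * I a := Nat.mul_le_mul_right _ hq1
        omega
      · intro a b hab
        by_contra! hba
        refine h0 ?_
        rw [alternant_eq_zero hab.ne, zero_mul, MvPolynomial.coeff_zero]
        have := h3 hab
        have hib := hind b
        simp only [Finsupp.add_apply] at *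
        omega
    refine ⟨_, hK, ?_, add_tsub_cancel_right _ _⟩
    rwa [add_tsub_cancel_right]
  · intro K hK h0
    rw [tsub_add_cancel_of_le (hle hK)]

end DworkTrace

/-! ### Monomials in the elementary symmetric polynomials -/

section LeadingTerm

variable {d : ℕ} {R : Type*} [CommRing R]

/-- The least element `(d, d - 1, …, 1)` of `strictVectors d N`, for `d ≤ N`. -/
noncomputable def staircase (d : ℕ) : Fin d →₀ ℕ :=
  Finsupp.equivFunOnFinite.symm fun i => d - i

@[simp] theorem staircase_apply (i : Fin d) : staircase d i = d - i := rfl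

theorem staircase_strictAnti : StrictAnti (staircase d) := by
  intro a b hab
  have := b.2
  simp only [staircase_apply]
  omega

theorem staircase_mem {N : ℕ} (h : d ≤ N) : staircase d ∈ strictVectors d N :=
  mem_strictVectors.2 ⟨fun a => by have := a.2; simp only [staircase_apply]; omega,
    fun a => (Nat.sub_le _ _).trans h, staircase_strictAnti⟩

theorem staircase_le {N : ℕ} {I : Fin d →₀ ℕ} (hI : I ∈ strictVectors d N) :
    staircase d ≤ I := by
  obtain ⟨h1, -, h3⟩ := mem_strictVectors.1 hI
  have key : ∀ m : ℕ, ∀ a : Fin d, (a : ℕ) + m + 1 = d → m + 1 ≤ I a := by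
    intro m
    induction m with
    | zero => exact fun a _ => h1 a
    | succ m ih =>
      intro a ha
      have hlt : (a : ℕ) + 1 < d := by omega
      have h2 := ih ⟨a + 1, hlt⟩ (by simp only; omega)
      have h4 : I ⟨a + 1, hlt⟩ < I a := h3 (by rw [Fin.lt_def]; simp)
      omega
  intro a
  have ha := a.2
  have := key (d - a - 1) a (by omega)
  rw [staircase_apply]
  omega

theorem sum_staircase : ∑ i, staircase d i = ∑ i : Fin d, ((i : ℕ) + 1) := by
  rw [← Equiv.sum_comp Fin.revPerm]
  refine Finset.sum_congr rfl fun i _ => ?_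
  have := i.2
  simp only [staircase_apply, Fin.revPerm_apply, Fin.val_rev]
  omega

theorem alternant_isHomogeneous (I : Fin d →₀ ℕ) :
    (alternant R I).IsHomogeneous (∑ i, I i) := by
  rw [alternant_eq_sum_rename]
  refine MvPolynomial.IsHomogeneous.sum _ _ _ fun σ _ => ?_
  have h : (MvPolynomial.rename σ (MvPolynomial.monomial I (1 : R))).IsHomogeneous (∑ i, I i) :=
    (MvPolynomial.isHomogeneous_monomial 1
      (Finsupp.degree_eq_sum I)).rename_isHomogeneous
  rcases Int.units_eq_one_or (Equiv.Perm.sign σ) with hs | hs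
  · rwa [hs, one_smul]
  · rw [hs, Units.neg_smul, one_smul]
    exact h.neg

theorem toLex_mapDomain_le {I : Fin d →₀ ℕ} (hI : StrictAnti I) (σ : Equiv.Perm (Fin d)) :
    toLex (I.mapDomain σ) ≤ toLex I := by
  by_contra! h
  obtain ⟨i, hlt, hi⟩ := Finsupp.Lex.lt_iff.1 h
  have happ (j : Fin d) : I.mapDomain σ j = I (σ.symm j) := by
    conv_lhs => rw [← Equiv.apply_symm_apply σ j, Finsupp.mapDomain_apply (Equiv.injective _)]
  simp only [ofLex_toLex, happ] at hlt hi
  have h1 : σ.symm i < i := hI.lt_iff_gt.1 hi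
  have h2 := hI.injective (hlt _ h1)
  exact h1.ne (σ.symm.injective h2.symm)

theorem supDegree_alternant_le {I : Fin d →₀ ℕ} (hI : StrictAnti I) :
    AddMonoidAlgebra.supDegree toLex (alternant R I) ≤ toLex I := by
  refine Finset.sup_le fun m hm => ?_
  rw [Finsupp.mem_support_iff] at hm
  change (alternant R I).coeff m ≠ 0 at hm
  rw [alternant_eq_sum_rename, MvPolynomial.coeff_sum] at hm
  obtain ⟨σ, -, hσ⟩ := Finset.exists_ne_zero_of_sum_ne_zero hm
  rw [MvPolynomial.rename_monomial, MvPolynomial.coeff_smul, MvPolynomial.coeff_monomial] at hσ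
  split_ifs at hσ with h
  · exact h ▸ toLex_mapDomain_le hI σ
  · simp at hσ

theorem coeff_alternant_self {I : Fin d →₀ ℕ} (hI : StrictAnti I) :
    (alternant R I).coeff I = 1 := by
  rw [alternant_eq_sum_rename, MvPolynomial.coeff_sum, Finset.sum_eq_single 1]
  · simp
  · intro σ _ hσ
    rw [MvPolynomial.rename_monomial, MvPolynomial.coeff_smul, MvPolynomial.coeff_monomial,
      if_neg, smul_zero]
    refine fun h => hσ (Equiv.ext fun i => hI.injective ?_)
    conv_lhs => rw [← h, Finsupp.mapDomain_apply (Equiv.injective _)]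
    rfl
  · simp

/-- The polynomial `G(e₁, …, e_d)` in the elementary symmetric polynomials. -/
noncomputable def esymmEval (d : ℕ) (R : Type*) [CommRing R] :
    MvPolynomial (Fin d) R →ₐ[R] MvPolynomial (Fin d) R :=
  MvPolynomial.aeval fun i : Fin d => MvPolynomial.esymm (Fin d) R (i + 1)

theorem esymmEval_eq (G : MvPolynomial (Fin d) R) :
    esymmEval d R G = (MvPolynomial.esymmAlgHom (Fin d) R d G).val :=
  (MvPolynomial.esymmAlgHom_apply ..).symm

theorem esymmEval_isSymmetric (G : MvPolynomial (Fin d) R) : (esymmEval d R G).IsSymmetric := by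
  rw [esymmEval_eq]
  exact (MvPolynomial.esymmAlgHom (Fin d) R d G).2

theorem exists_esymmEval_eq {g : MvPolynomial (Fin d) R} (hg : g.IsSymmetric) :
    ∃ G, esymmEval d R G = g := by
  obtain ⟨G, hG⟩ := MvPolynomial.esymmAlgHom_surjective (σ := Fin d) (R := R) (n := d) (by simp)
    ⟨g, hg⟩
  exact ⟨G, by rw [esymmEval_eq, hG]⟩

theorem esymmEval_monomial_isHomogeneous (J : Fin d →₀ ℕ) :
    (esymmEval d R (MvPolynomial.monomial J 1)).IsHomogeneous (∑ i : Fin d, (i + 1) * J i) := by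
  rw [esymmEval, MvPolynomial.aeval_monomial, Finsupp.prod_fintype _ _ (by simp), map_one, one_mul]
  refine MvPolynomial.IsHomogeneous.prod _ _ _ fun i _ =>
    MvPolynomial.IsHomogeneous.pow ?_ (J i)
  rw [MvPolynomial.esymm_eq_sum_monomial]
  refine MvPolynomial.IsHomogeneous.sum _ _ _ fun s hs =>
    MvPolynomial.isHomogeneous_monomial 1 ?_
  rw [map_sum, Finset.sum_congr rfl fun _ _ => Finsupp.degree_single _ _, Finset.sum_const,
    (Finset.mem_powersetCard.1 hs).2, smul_eq_mul, mul_one]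

/-- The lexicographically leading monomial of `∏ e_i^{q-1}` is `x^{(q-1)δ}`, and that of the
alternant of `δ` is `x^δ`, where `δ` is the staircase. -/
theorem coeff_alternant_staircase_mul [Nontrivial R] {q : ℕ} (hq : 1 ≤ q) {J : Fin d →₀ ℕ}
    (hJ : ∀ i, J i = q - 1) :
    (alternant R (staircase d) * esymmEval d R (MvPolynomial.monomial J 1)).coeff
      (q • staircase d) = 1 := by
  have hsup : AddMonoidAlgebra.supDegree toLex (esymmEval d R (MvPolynomial.monomial J 1)) =
      toLex ((q - 1) • staircase d) := by
    rw [esymmEval_eq, ← ofLex_inj, ofLex_toLex]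
    have hacc : ⇑(ofLex (AddMonoidAlgebra.supDegree toLex
        (MvPolynomial.esymmAlgHomMonomial (Fin d) J (1 : R)))) = Fin.accumulate d d J :=
      MvPolynomial.supDegree_esymmAlgHomMonomial one_ne_zero J le_rfl
    ext i
    refine (congrFun hacc i).trans ?_
    rw [Fin.accumulate_apply]
    simp_rw [hJ]
    rw [Finset.sum_const, Finsupp.smul_apply, staircase_apply, smul_eq_mul, smul_eq_mul, mul_comm]
    refine congrArg ((q - 1) * ·) ((congrArg Finset.card ?_).trans (Fin.card_Ici i))
    ext j
    rw [Finset.mem_filter, Finset.mem_Ici]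
    exact ⟨fun h => h.2, fun h => ⟨Finset.mem_univ _, h⟩⟩
  have hq' : q • staircase d = staircase d + (q - 1) • staircase d := by
    conv_lhs => rw [← Nat.sub_add_cancel hq, add_smul, one_smul, add_comm]
  have hlead : (esymmEval d R (MvPolynomial.monomial J 1)).coeff ((q - 1) • staircase d) = 1 := by
    have := MvPolynomial.leadingCoeff_esymmAlgHomMonomial (R := R) (r := 1) J (le_refl d)
    rw [AddMonoidAlgebra.leadingCoeff, MvPolynomial.esymmAlgHomMonomial, ← esymmEval_eq, hsup,
      Function.leftInverse_invFun toLex.injective] at this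
    exact this
  have := AddMonoidAlgebra.coeff_add_of_supDegree_le (D := toLex) toLex_add toLex.injective
    (supDegree_alternant_le (R := R) (staircase_strictAnti (d := d))) hsup.le
  rw [hq']
  refine this.trans ?_
  exact (congrArg₂ (· * ·) (coeff_alternant_self staircase_strictAnti) hlead).trans (mul_one 1)

/-- A diagonal entry at `I` requires `(q - 1) |I| = ∑ (i + 1) J_i`, and `|I|` is at least the sum of
the staircase, so only `J = (q - 1, …, q - 1)` and the staircase itself contribute. -/
theorem dworkTrace_esymmEval_monomial [Nontrivial R] {q N : ℕ} (hq : 2 ≤ q) (hN : d ≤ N)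
    {J : Fin d →₀ ℕ} (hJ : ∀ i, J i ≤ q - 1) :
    dworkTrace R d q N (esymmEval d R (MvPolynomial.monomial J 1)) =
      if ∀ i, J i = q - 1 then 1 else 0 := by
  have hdeg {I : Fin d →₀ ℕ}
      (h0 : (alternant R I * esymmEval d R (MvPolynomial.monomial J 1)).coeff (q • I) ≠ 0) :
      (q - 1) * ∑ i, I i = ∑ i : Fin d, ((i : ℕ) + 1) * J i := by
    have h1 := ((alternant_isHomogeneous (R := R) I).mul
      (esymmEval_monomial_isHomogeneous J)) h0
    rw [Finsupp.weight_apply, Finsupp.sum_fintype _ _ (by simp)] at h1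
    simp only [Finsupp.smul_apply, smul_eq_mul, Pi.one_apply, mul_one] at h1
    rw [← Finset.mul_sum] at h1
    obtain ⟨t, rfl⟩ : ∃ t, q = t + 1 := ⟨q - 1, by omega⟩
    rw [add_mul, one_mul] at h1
    simp only [Nat.add_sub_cancel]
    omega
  have hle {I : Fin d →₀ ℕ} (hI : I ∈ strictVectors d N) :
      ∑ i : Fin d, ((i : ℕ) + 1) ≤ ∑ i, I i := by
    rw [← sum_staircase]
    exact Finset.sum_le_sum fun i _ => staircase_le hI i
  rw [dworkTrace_apply]
  split_ifs with hall
  · rw [Finset.sum_eq_single (staircase d), coeff_alternant_staircase_mul (by omega) hall]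
    · intro I hI hne
      by_contra h0
      have h1 := hdeg h0
      simp_rw [hall] at h1
      rw [← Finset.sum_mul, mul_comm, Nat.mul_left_inj (by omega), ← sum_staircase] at h1
      refine hne (Finsupp.ext fun i => ?_)
      exact (((Finset.sum_eq_sum_iff_of_le fun i _ => staircase_le hI i).1 h1.symm) i
        (Finset.mem_univ _)).symm
    · exact fun h => (h (staircase_mem hN)).elim
  · push Not at hall
    obtain ⟨i, hi⟩ := hall
    refine Finset.sum_eq_zero fun I hI => ?_
    by_contra h0
    have h1 := hdeg h0
    have h2 : ∑ i : Fin d, ((i : ℕ) + 1) * J i < ∑ i : Fin d, ((i : ℕ) + 1) * (q - 1) :=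
      Finset.sum_lt_sum (fun j _ => Nat.mul_le_mul_left _ (hJ j))
        ⟨i, Finset.mem_univ _, Nat.mul_lt_mul_of_pos_left (lt_of_le_of_ne (hJ i) hi)
          (Nat.succ_pos _)⟩
    rw [← Finset.sum_mul, mul_comm] at h2
    have h3 := Nat.mul_le_mul_left (q - 1) (hle hI)
    omega

end LeadingTerm

/-! ### The trace formula on affine space -/

section PointSum

variable (F : Type*) [Field F] [Fintype F] {d : ℕ} {R : Type*} [CommRing R] [Algebra F R]

theorem sum_pow_pred_card (j : ℕ) (hj : j ≤ Fintype.card F - 1) :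
    ∑ x : F, x ^ j = if j = Fintype.card F - 1 then -1 else 0 := by
  classical
  split_ifs with h
  · have hq : 1 < Fintype.card F := Fintype.one_lt_card
    subst h
    rw [← Finset.sum_erase_add _ _ (Finset.mem_univ (0 : F)), zero_pow (by omega), add_zero,
      Finset.sum_congr rfl fun x hx =>
        FiniteField.pow_card_sub_one_eq_one x (Finset.ne_of_mem_erase hx),
      Finset.sum_const, Finset.card_erase_of_mem (Finset.mem_univ _), Finset.card_univ, nsmul_one,
      Nat.cast_sub hq.le, FiniteField.cast_card_eq_zero]
    simp
  · exact FiniteField.sum_pow_lt_card_sub_one F j (lt_of_le_of_ne hj h)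

theorem sum_eval_monomial {J : Fin d →₀ ℕ} (hJ : ∀ i, J i ≤ Fintype.card F - 1) :
    ∑ e : Fin d → F, MvPolynomial.eval (fun i => algebraMap F R (e i))
      (MvPolynomial.monomial J (1 : R)) =
      if ∀ i, J i = Fintype.card F - 1 then (-1) ^ d else 0 := by
  have h1 (e : Fin d → F) : MvPolynomial.eval (fun i => algebraMap F R (e i))
      (MvPolynomial.monomial J (1 : R)) = algebraMap F R (∏ i, e i ^ J i) := by
    rw [MvPolynomial.eval_monomial, Finsupp.prod_fintype _ _ (by simp), one_mul, map_prod]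
    simp
  simp_rw [h1]
  rw [← map_sum, ← Fintype.piFinset_univ,
    ← Finset.prod_univ_sum (fun _ => Finset.univ) fun i (x : F) => x ^ J i,
    Finset.prod_congr rfl fun i _ => sum_pow_pred_card F (J i) (hJ i)]
  split_ifs with hall
  · simp [hall]
  · push Not at hall
    obtain ⟨i, hi⟩ := hall
    rw [Finset.prod_eq_zero (Finset.mem_univ i) (if_neg hi), map_zero]

/-- The trace formula: the trace attached to a symmetric polynomial `G(e₁, …, e_d)` computes, up to
sign, the sum of `G` over the rational points of the affine space with coordinates `e_i`. Both sides
are unchanged when some `e_i^q` is replaced by `e_i`, which leaves the monomials with exponents less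
than `q`. -/
theorem eventually_dworkTrace_esymmEval [Nontrivial R] (G : MvPolynomial (Fin d) R) :
    ∀ᶠ N in Filter.atTop, dworkTrace R d (Fintype.card F) N (esymmEval d R G) =
      (-1) ^ d * ∑ e : Fin d → F, MvPolynomial.eval (fun i => algebraMap F R (e i)) G := by
  have hq : 1 < Fintype.card F := Fintype.one_lt_card
  have key : ∀ J : Fin d →₀ ℕ, ∀ᶠ N in Filter.atTop, dworkTrace R d (Fintype.card F) N
      (esymmEval d R (MvPolynomial.monomial J 1)) = (-1) ^ d * ∑ e : Fin d → F,
        MvPolynomial.eval (fun i => algebraMap F R (e i)) (MvPolynomial.monomial J 1) := by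
    intro J
    induction hn : J.degree using Nat.strong_induction_on generalizing J with
    | _ n ih =>
    by_cases hJ : ∀ i, J i ≤ Fintype.card F - 1
    · filter_upwards [Filter.eventually_ge_atTop d] with N hN
      rw [dworkTrace_esymmEval_monomial hq hN hJ, sum_eval_monomial F hJ]
      split_ifs
      · rw [← mul_pow]; simp
      · simp
    · push Not at hJ
      obtain ⟨i, hi⟩ := hJ
      set J₀ := J - Finsupp.single i (Fintype.card F) with hJ₀
      have hJeq : J = J₀ + Finsupp.single i (Fintype.card F) := by
        rw [hJ₀, tsub_add_cancel_of_le]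
        rw [Finsupp.single_le_iff]
        omega
      have hmon (k : ℕ) : MvPolynomial.monomial (J₀ + Finsupp.single i k) (1 : R) =
          MvPolynomial.X i ^ k * MvPolynomial.monomial J₀ 1 := by
        rw [MvPolynomial.X_pow_eq_monomial, MvPolynomial.monomial_mul, one_mul, add_comm]
      have hlt : (J₀ + Finsupp.single i 1).degree < n := by
        rw [← hn, hJeq, map_add, map_add, Finsupp.degree_single, Finsupp.degree_single]
        omega
      filter_upwards [ih _ hlt _ rfl, eventually_dworkTrace_esymm_pow_mul F
        (esymmEval_isSymmetric (MvPolynomial.monomial J₀ (1 : R))) (i + 1)] with N h1 h2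
      rw [hJeq]
      have hE : esymmEval d R (MvPolynomial.X i) = MvPolynomial.esymm (Fin d) R (i + 1) :=
        MvPolynomial.aeval_X _ _
      have h3 : dworkTrace R d (Fintype.card F) N (esymmEval d R
          (MvPolynomial.monomial (J₀ + Finsupp.single i (Fintype.card F)) 1)) =
          dworkTrace R d (Fintype.card F) N (esymmEval d R
          (MvPolynomial.monomial (J₀ + Finsupp.single i 1) 1)) := by
        rw [hmon, hmon, map_mul (esymmEval d R), map_mul (esymmEval d R), map_pow (esymmEval d R),
          map_pow (esymmEval d R), hE, pow_one, h2]
      rw [h3, h1]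
      congr 1
      refine Finset.sum_congr rfl fun e _ => ?_
      rw [hmon, hmon, map_mul, map_mul, pow_one, map_pow, MvPolynomial.eval_X,
        ← map_pow (algebraMap F R), FiniteField.pow_card]
  induction G using MvPolynomial.induction_on' with
  | monomial J a =>
    filter_upwards [key J] with N hN
    have h1 : MvPolynomial.monomial J a = MvPolynomial.C a * MvPolynomial.monomial J 1 := by
      rw [MvPolynomial.C_mul_monomial, mul_one]
    simp_rw [h1, map_mul, MvPolynomial.eval_C]
    rw [← Finset.mul_sum, mul_left_comm, ← hN, ← MvPolynomial.algebraMap_eq, AlgHom.commutes,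
      ← Algebra.smul_def, map_smul, smul_eq_mul]
  | add G H hG hH =>
    filter_upwards [hG, hH] with N h1 h2
    simp_rw [map_add]
    rw [h1, h2, Finset.sum_add_distrib, mul_add]

end PointSum

/-! ### Principal minors -/

section Minors

variable {d : ℕ} {R : Type*} [CommRing R]

/-- The polynomial `Q(x₁) ⋯ Q(x_d)`. -/
noncomputable def prodEval (Q : R[X]) (d : ℕ) : MvPolynomial (Fin d) R :=
  ∏ a, aeval (MvPolynomial.X a) Q

theorem prodEval_isSymmetric (Q : R[X]) : (prodEval Q d).IsSymmetric := by
  intro σ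
  rw [prodEval, map_prod]
  conv_rhs => rw [← Equiv.prod_comp σ]
  refine Finset.prod_congr rfl fun a _ => ?_
  rw [← aeval_algHom_apply, MvPolynomial.rename_X]

theorem coeff_prod_aeval_X (p : Fin d → R[X]) (L : Fin d →₀ ℕ) :
    (∏ a, aeval (MvPolynomial.X a : MvPolynomial (Fin d) R) (p a)).coeff L =
      ∏ a, (p a).coeff (L a) := by
  classical
  have h (a : Fin d) : aeval (MvPolynomial.X a : MvPolynomial (Fin d) R) (p a) =
      ∑ j ∈ (p a).support, MvPolynomial.monomial (Finsupp.single a j) ((p a).coeff j) := by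
    rw [aeval_eq_sum_range' (n := (p a).natDegree + 1) (Nat.lt_succ_self _)]
    rw [Finset.sum_subset supp_subset_range_natDegree_succ]
    · refine Finset.sum_congr rfl fun j _ => ?_
      rw [MvPolynomial.X_pow_eq_monomial, MvPolynomial.smul_monomial, smul_eq_mul, mul_one]
    · intro j _ hj
      rw [notMem_support_iff.1 hj, map_zero]
  have hmon (v : Fin d → ℕ) :
      ∏ a, MvPolynomial.monomial (Finsupp.single a (v a)) ((p a).coeff (v a)) =
        MvPolynomial.monomial (Finsupp.equivFunOnFinite.symm v) (∏ a, (p a).coeff (v a)) := by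
    have hv : Finsupp.equivFunOnFinite.symm v = ∑ a, Finsupp.single a (v a) := by
      ext b
      simp [Finsupp.finsetSum_apply, Finsupp.single_apply]
    rw [hv, MvPolynomial.monomial_sum_index, map_prod, ← Finset.prod_mul_distrib]
    refine Finset.prod_congr rfl fun a _ => ?_
    rw [MvPolynomial.C_mul_monomial, mul_one]
  simp_rw [h, Finset.prod_univ_sum, hmon, MvPolynomial.coeff_sum, MvPolynomial.coeff_monomial]
  rw [Finset.sum_eq_single (⇑L)]
  · rw [if_pos]
    ext; rfl
  · intro v _ hv
    rw [if_neg]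
    rintro rfl
    exact hv rfl
  · intro hL
    rw [if_pos (by ext; rfl)]
    rw [Fintype.mem_piFinset] at hL
    push Not at hL
    obtain ⟨a, ha⟩ := hL
    exact Finset.prod_eq_zero (Finset.mem_univ a) (notMem_support_iff.1 ha)

theorem coeff_alternant_mul_prodEval (Q : R[X]) (I L : Fin d →₀ ℕ) :
    (alternant R I * prodEval Q d).coeff L =
      (Matrix.of fun a b => (X ^ I b * Q).coeff (L a)).det := by
  rw [mul_comm, prodEval, alternant, ← Matrix.det_mul_column, ← Matrix.det_transpose,
    ← Matrix.det_transpose (Matrix.of _), Matrix.det_apply, Matrix.det_apply,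
    MvPolynomial.coeff_sum]
  refine Finset.sum_congr rfl fun σ _ => ?_
  rw [MvPolynomial.coeff_smul]
  congr 1
  simp only [Matrix.transpose_apply, Matrix.of_apply]
  rw [← coeff_prod_aeval_X fun a => X ^ I (σ a) * Q]
  congr 1
  refine Finset.prod_congr rfl fun a _ => ?_
  rw [map_mul, map_pow, aeval_X, mul_comm]

/-- The matrix of `h ↦ ψ(Q h)` in `θ, θ², …, θ^k`, where `ψ` sends `θ^{qi}` to `θ^i` and kills the
other powers of `θ`. The entry is the coefficient of `θ^{qi-j}` in `Q`, written without
subtraction; indices are shifted by one. -/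
noncomputable def cartierMatrix (Q : R[X]) (q k : ℕ) : Matrix (Fin k) (Fin k) R :=
  Matrix.of fun i j => (X ^ ((j : ℕ) + 1) * Q).coeff (q * ((i : ℕ) + 1))

/-- The decreasing enumeration of `{j + 1 | j ∈ s}`. -/
noncomputable def vectorOfFinset {k : ℕ} (s : Finset (Fin k)) (hs : s.card = d) : Fin d →₀ ℕ :=
  Finsupp.equivFunOnFinite.symm fun a => (s.orderEmbOfFin hs a.rev : ℕ) + 1

theorem vectorOfFinset_apply {k : ℕ} (s : Finset (Fin k)) (hs : s.card = d) (a : Fin d) :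
    vectorOfFinset s hs a = (s.orderEmbOfFin hs a.rev : ℕ) + 1 := rfl

/-- Independence of `N`: a minor with an index beyond `k` has a zero row. -/
theorem dworkTrace_prodEval {Q : R[X]} {q k N : ℕ} (hQ : Q.natDegree ≤ (q - 1) * k) (hq : 1 < q)
    (hN : k ≤ N) :
    dworkTrace R d q N (prodEval Q d) = ∑ s ∈ Finset.univ.powersetCard d,
      ((cartierMatrix Q q k).submatrix (Subtype.val : s → Fin k) Subtype.val).det := by
  have hsub : strictVectors d k ⊆ strictVectors d N := by
    intro I hI
    obtain ⟨h1, h2, h3⟩ := mem_strictVectors.1 hI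
    exact mem_strictVectors.2 ⟨h1, fun a => (h2 a).trans hN, h3⟩
  rw [dworkTrace_apply, ← Finset.sum_subset hsub]
  · symm
    refine Finset.sum_bij
      (fun s hs => vectorOfFinset s (Finset.mem_powersetCard.1 hs).2) ?_ ?_ ?_ ?_
    · intro s hs
      refine mem_strictVectors.2 ⟨fun a => Nat.le_add_left _ _, fun a => Fin.is_lt _, ?_⟩
      intro a b hab
      rw [vectorOfFinset_apply, vectorOfFinset_apply, Nat.add_lt_add_iff_right, ← Fin.lt_def,
        OrderEmbedding.lt_iff_lt]
      exact Fin.rev_lt_rev.2 hab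
    · intro s hs t ht hst
      have hst' : ⇑(s.orderEmbOfFin (Finset.mem_powersetCard.1 hs).2) =
          t.orderEmbOfFin (Finset.mem_powersetCard.1 ht).2 := by
        funext a
        have := DFunLike.congr_fun hst a.rev
        rw [vectorOfFinset_apply, vectorOfFinset_apply, Fin.rev_rev] at this
        exact Fin.ext (Nat.succ_injective this)
      rw [← Finset.coe_inj, ← Finset.range_orderEmbOfFin s (Finset.mem_powersetCard.1 hs).2, hst',
        Finset.range_orderEmbOfFin]
    · intro I hI
      obtain ⟨h1, h2, h3⟩ := mem_strictVectors.1 hI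
      let f : Fin d → Fin k := fun a => ⟨I a.rev - 1, by have := h1 a.rev; have := h2 a.rev; omega⟩
      have hf : StrictMono f := by
        intro a b hab
        have := h3 (Fin.rev_lt_rev.2 hab)
        have := h1 a.rev
        rw [Fin.lt_def]
        simp only [f]
        omega
      have hcard : (Finset.univ.image f).card = d := by
        rw [Finset.card_image_of_injective _ hf.injective, Finset.card_univ, Fintype.card_fin]
      refine ⟨Finset.univ.image f,
        Finset.mem_powersetCard.2 ⟨Finset.subset_univ _, hcard⟩, Finsupp.ext fun a => ?_⟩
      rw [vectorOfFinset_apply, ← Finset.orderEmbOfFin_unique hcard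
        (fun a => Finset.mem_image_of_mem f (Finset.mem_univ a)) hf]
      have := h1 a
      simp only [f, Fin.rev_rev]
      omega
    · intro s hs
      have hc := (Finset.mem_powersetCard.1 hs).2
      rw [coeff_alternant_mul_prodEval, ← Matrix.det_submatrix_equiv_self
        (Fin.revPerm.trans (s.orderIsoOfFin hc).toEquiv)]
      rfl
  · intro I hI hIk
    obtain ⟨h1, h2, h3⟩ := mem_strictVectors.1 hI
    obtain ⟨a, ha⟩ : ∃ a, k < I a := by
      by_contra! h
      exact hIk (mem_strictVectors.2 ⟨h1, h, h3⟩)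
    have hd : 0 < d := a.pos
    have h0 (b : Fin d) : I b ≤ I ⟨0, hd⟩ := h3.antitone (Nat.zero_le (b : ℕ))
    rw [coeff_alternant_mul_prodEval]
    -- All degrees in the row of the largest index exceed the degree of `Q`.
    refine Matrix.det_eq_zero_of_row_eq_zero ⟨0, hd⟩ fun b => ?_
    rw [Matrix.of_apply, Finsupp.smul_apply, smul_eq_mul, coeff_X_pow_mul']
    split_ifs
    · refine coeff_eq_zero_of_natDegree_lt ?_
      obtain ⟨t, rfl⟩ : ∃ t, q = t + 1 := ⟨q - 1, by omega⟩
      have h4 : t * k < t * I ⟨0, hd⟩ :=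
        Nat.mul_lt_mul_of_pos_left (ha.trans_le (h0 a)) (by omega)
      have h5 := h0 b
      rw [Nat.add_sub_cancel] at hQ
      rw [add_mul, one_mul]
      omega
    · rfl

/-- `charpolyRev M` is `det (1 - M U)`. -/
theorem coeff_charpolyRev {n : Type*} [Fintype n] [DecidableEq n] (M : Matrix n n R) (d : ℕ) :
    M.charpolyRev.coeff d = (-1) ^ d * ∑ s ∈ Finset.univ.powersetCard d,
      (M.submatrix (Subtype.val : s → n) Subtype.val).det := by
  have h : M.charpolyRev = (1 + (X : R[X]) • (-M).map C).det := by
    rw [Matrix.charpolyRev, sub_eq_add_neg, Matrix.map_neg C (map_neg C) M, smul_neg]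
  rw [h, Matrix.coeff_det_one_add_X_smul_eq_sum_minors, Finset.mul_sum]
  refine Finset.sum_congr rfl fun s hs => ?_
  rw [Matrix.submatrix_neg]
  exact (Matrix.det_neg _).trans (by rw [Fintype.card_coe, (Finset.mem_powersetCard.1 hs).2])

end Minors

/-! ### Products over roots -/

section RootProduct

variable {F : Type*} [Field F] (K : Type*) [Field K] [Algebra F K]
  {R : Type*} [CommRing R] [Algebra K R]

/-- The product of the values of `Q` at the roots of `f` in `K`. -/
noncomputable def rootProd (Q : R[X]) (f : F[X]) : R :=
  ((f.map (algebraMap F K)).roots.map fun a => Q.eval (algebraMap K R a)).prod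

theorem rootProd_mul (Q : R[X]) {f g : F[X]} (hf : f ≠ 0) (hg : g ≠ 0) :
    rootProd K Q (f * g) = rootProd K Q f * rootProd K Q g := by
  rw [rootProd, Polynomial.map_mul, roots_mul, Multiset.map_add, Multiset.prod_add,
    rootProd, rootProd]
  exact mul_ne_zero ((Polynomial.map_ne_zero_iff (algebraMap F K).injective).2 hf)
    ((Polynomial.map_ne_zero_iff (algebraMap F K).injective).2 hg)

theorem rootProd_one (Q : R[X]) : rootProd K Q (1 : F[X]) = 1 := by
  simp [rootProd]

end RootProduct

/-! ### Sums over monic polynomials -/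

section Character

/-- The monic polynomials of degree `d`. -/
noncomputable def monics (F : Type*) [Field F] [Fintype F] (d : ℕ) : Finset F[X] :=
  open Classical in
  Finset.univ.image fun c : Fin d → F => X ^ d + ∑ i : Fin d, C (c i) * X ^ (i : ℕ)

variable {F : Type*} [Field F] [Fintype F]

theorem mem_monics {d : ℕ} {f : F[X]} : f ∈ monics F d ↔ f.Monic ∧ f.natDegree = d := by
  simp only [monics, Finset.mem_image, Finset.mem_univ, true_and]
  constructor
  · rintro ⟨c, rfl⟩
    have h := degree_sum_fin_lt c
    refine ⟨monic_X_pow_add h, ?_⟩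
    exact natDegree_eq_of_degree_eq_some (by rw [degree_add_eq_left_of_degree_lt] <;>
      simp [h])
  · rintro ⟨hf, rfl⟩
    refine ⟨fun i => f.coeff i, ?_⟩
    rw [Fin.sum_univ_eq_sum_range (fun i => C (f.coeff i) * X ^ i)]
    exact hf.as_sum.symm

/-- The values `(-1)^{i+1} f_{d-1-i}`, for `f` monic of degree `d`, of the elementary symmetric
polynomials at the roots of `f`. -/
def esymmOfCoeff (d : ℕ) (f : F[X]) (i : Fin d) : F :=
  (-1) ^ ((i : ℕ) + 1) * f.coeff (i.rev : ℕ)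

theorem sum_monics {d : ℕ} {R : Type*} [AddCommMonoid R] (φ : (Fin d → F) → R) :
    ∑ f ∈ monics F d, φ (esymmOfCoeff d f) = ∑ e : Fin d → F, φ e := by
  refine Finset.sum_bij (fun f _ => esymmOfCoeff d f) (fun _ _ => Finset.mem_univ _) ?_ ?_
    (fun _ _ => rfl)
  · intro f hf g hg hfg
    obtain ⟨hf1, hf2⟩ := mem_monics.1 hf
    obtain ⟨hg1, hg2⟩ := mem_monics.1 hg
    ext j
    rcases lt_trichotomy j d with hj | rfl | hj
    · have := congrFun hfg (Fin.rev ⟨j, hj⟩)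
      simp only [esymmOfCoeff, Fin.rev_rev] at this
      exact mul_left_cancel₀ (pow_ne_zero _ (neg_ne_zero.2 one_ne_zero)) this
    · rw [← hf2, hf1.coeff_natDegree, hf2, ← hg2, hg1.coeff_natDegree]
    · rw [coeff_eq_zero_of_natDegree_lt (hf2.trans_lt hj),
        coeff_eq_zero_of_natDegree_lt (hg2.trans_lt hj)]
  · intro e _
    refine ⟨X ^ d + ∑ i : Fin d, C ((-1) ^ ((i.rev : ℕ) + 1) * e i.rev) * X ^ (i : ℕ),
      ?_, ?_⟩
    · classical
      exact Finset.mem_image_of_mem _ (Finset.mem_univ _)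
    · funext i
      rw [esymmOfCoeff, coeff_add, coeff_X_pow, if_neg (Fin.is_lt _).ne, zero_add,
        finsetSum_coeff, Finset.sum_eq_single i.rev]
      · rw [coeff_C_mul_X_pow, if_pos rfl, Fin.rev_rev, ← mul_assoc, ← mul_pow]
        simp
      · intro j _ hj
        rw [coeff_C_mul_X_pow, if_neg]
        exact fun h => hj (Fin.ext h.symm)
      · exact fun h => (h (Finset.mem_univ _)).elim

variable (K : Type*) [Field K] [Algebra F K] {R : Type*} [CommRing R] [Algebra K R]
  [Algebra F R] [IsScalarTower F K R] [IsAlgClosed K]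

theorem rootProd_eq_eval (Q : R[X]) {d : ℕ} {f : F[X]} (hf : f ∈ monics F d)
    {G : MvPolynomial (Fin d) R} (hG : esymmEval d R G = prodEval Q d) :
    rootProd K Q f = MvPolynomial.eval (fun i => algebraMap F R (esymmOfCoeff d f i)) G := by
  obtain ⟨hf1, hf2⟩ := mem_monics.1 hf
  set p := f.map (algebraMap F K) with hp
  have hpd : p.natDegree = d := by rw [hp, natDegree_map, hf2]
  have hcard : p.roots.card = p.natDegree :=
    (splits_iff_card_roots.1 (IsAlgClosed.splits p))
  obtain ⟨x, hx⟩ : ∃ x : Fin d → K, Finset.univ.val.map x = p.roots := by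
    have hl : p.roots.toList.length = d := by rw [Multiset.length_toList, hcard, hpd]
    refine ⟨fun i => p.roots.toList.get (i.cast hl.symm), ?_⟩
    subst hl
    conv_rhs => rw [← Multiset.coe_toList p.roots]
    rw [Fin.univ_val_map]
    congr 1
    exact List.ofFn_get _
  have hes (i : Fin d) : algebraMap F R (esymmOfCoeff d f i) =
      MvPolynomial.aeval (fun a => algebraMap K R (x a))
        (MvPolynomial.esymm (Fin d) R (i + 1)) := by
    have h1 : algebraMap F K (f.coeff (i.rev : ℕ)) =
        (-1) ^ ((i : ℕ) + 1) * p.roots.esymm (i + 1) := by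
      have hi := i.2
      have := coeff_eq_esymm_roots_of_card hcard (k := (i.rev : ℕ))
        (by rw [hpd]; exact (Fin.is_lt _).le)
      rw [hpd, Fin.val_rev, show d - (d - ((i : ℕ) + 1)) = i + 1 by omega,
        (hf1.map _).leadingCoeff, one_mul, ← Fin.val_rev, hp, coeff_map] at this
      exact this
    have h2 : algebraMap F K (esymmOfCoeff d f i) = p.roots.esymm (i + 1) := by
      rw [esymmOfCoeff, map_mul, h1, ← mul_assoc, map_pow, map_neg, map_one, ← mul_pow]
      simp
    rw [IsScalarTower.algebraMap_apply F K R, h2, MvPolynomial.aeval_esymm_eq_multiset_esymm,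
      ← hx, Finset.esymm_map_val, Finset.esymm_map_val, map_sum]
    simp_rw [map_prod]
  have h3 := congrArg (MvPolynomial.aeval fun a => algebraMap K R (x a)) hG
  rw [esymmEval, MvPolynomial.comp_aeval_apply, ← funext hes, prodEval, map_prod] at h3
  rw [← MvPolynomial.coe_aeval_eq_eval, RingHom.coe_coe, h3, rootProd, ← hp, ← hx,
    Multiset.map_map, ← Finset.prod_eq_multiset_prod]
  refine Finset.prod_congr rfl fun a _ => ?_
  rw [← aeval_algHom_apply, MvPolynomial.aeval_X, coe_aeval_eq_eval, Function.comp_apply]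

/-- The sum of `Q(roots of f)` over the monic polynomials `f` of degree `d` is a coefficient of
the reversed characteristic polynomial of the matrix of `ψ ∘ Q`. -/
theorem sum_rootProd [Nontrivial R] {Q : R[X]} {k : ℕ}
    (hQ : Q.natDegree ≤ (Fintype.card F - 1) * k) (d : ℕ) :
    ∑ f ∈ monics F d, rootProd K Q f =
      (cartierMatrix Q (Fintype.card F) k).charpolyRev.coeff d := by
  obtain ⟨G, hG⟩ := exists_esymmEval_eq (prodEval_isSymmetric (d := d) Q)
  obtain ⟨N, h1, h2⟩ := ((eventually_dworkTrace_esymmEval F G).and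
    (Filter.eventually_ge_atTop k)).exists
  rw [hG, dworkTrace_prodEval hQ Fintype.one_lt_card h2] at h1
  rw [coeff_charpolyRev, h1, ← mul_assoc, ← mul_pow, ← sum_monics]
  simp only [mul_neg, mul_one, neg_neg, one_pow, one_mul]
  exact Finset.sum_congr rfl fun f hf => rootProd_eq_eval K Q hf hG

end Character

/-! ### Euler products of multiplicative functions -/

section EulerProduct

theorem Place.dvd_iff_eq {F : Type*} [Field F] {p p' : Place F} : p'.1 ∣ p.1 ↔ p' = p := by
  refine ⟨fun h => ?_, fun h => h ▸ dvd_rfl⟩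
  have := (p'.2.2.associated_of_dvd p.2.2 h)
  exact Subtype.ext (eq_of_monic_of_associated p'.2.1 p.2.1 this)

variable {F : Type*} [Field F] [Fintype F] {R : Type*} [CommRing R]

/-- The series `∑ χ(f) U^{deg f}` over the monic `f` which no place in `s` divides. -/
noncomputable def primeToSeries (χ : F[X] → R) (s : Finset (Place F)) : PowerSeries R :=
  open Classical in
  PowerSeries.mk fun n => ∑ f ∈ monics F n with ∀ p ∈ s, ¬ p.1 ∣ f, χ f

/-- Multiplication by an Euler factor removes the multiples of the place. -/
theorem primeToSeries_mul {χ : F[X] → R} (hχ : ∀ f g, f ≠ 0 → g ≠ 0 → χ (f * g) = χ f * χ g)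
    [DecidableEq (Place F)] {s : Finset (Place F)} {p : Place F} (hp : p ∉ s) :
    primeToSeries χ s * (1 - PowerSeries.C (χ p.1) * PowerSeries.X ^ p.1.natDegree) =
      primeToSeries χ (insert p s) := by
  classical
  ext n
  rw [mul_sub, mul_one, map_sub, mul_left_comm, PowerSeries.coeff_C_mul,
    PowerSeries.coeff_mul_X_pow']
  simp only [primeToSeries, PowerSeries.coeff_mk]
  rw [sub_eq_iff_eq_add,
    ← Finset.sum_filter_add_sum_filter_not _ (fun f => ¬ p.1 ∣ f), Finset.filter_filter,
    Finset.filter_filter]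
  congr 1
  · refine Finset.sum_congr (Finset.filter_congr fun f _ => ?_) fun _ _ => rfl
    rw [Finset.forall_mem_insert, and_comm]
  · split_ifs with hn
    · rw [Finset.mul_sum]
      symm
      refine Finset.sum_bij (fun f _ => p.1 * f) ?_ ?_ ?_ ?_
      · intro f hf
        obtain ⟨hf, hs⟩ := Finset.mem_filter.1 hf
        obtain ⟨hf1, hf2⟩ := mem_monics.1 hf
        refine Finset.mem_filter.2 ⟨mem_monics.2 ⟨p.2.1.mul hf1, ?_⟩, fun p' hp' hdvd => ?_, ?_⟩
        · rw [p.2.1.natDegree_mul hf1, hf2, Nat.add_sub_cancel' hn]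
        · rcases p'.2.2.prime.dvd_or_dvd hdvd with h | h
          · exact hp (Place.dvd_iff_eq.1 h ▸ hp')
          · exact hs p' hp' h
        · exact not_not.2 (dvd_mul_right _ _)
      · intro f _ g _ h
        exact mul_left_cancel₀ p.2.2.ne_zero h
      · intro g hg
        obtain ⟨hg, hs, hdvd⟩ := Finset.mem_filter.1 hg
        obtain ⟨hg1, hg2⟩ := mem_monics.1 hg
        obtain ⟨f, rfl⟩ := not_not.1 hdvd
        have hf1 : f.Monic := p.2.1.of_mul_monic_left hg1
        rw [p.2.1.natDegree_mul hf1] at hg2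
        refine ⟨f, Finset.mem_filter.2 ⟨mem_monics.2 ⟨hf1, by omega⟩, fun p' hp' h => ?_⟩, rfl⟩
        exact hs p' hp' (dvd_mul_of_dvd_right h _)
      · intro f hf
        exact (hχ _ _ p.2.2.ne_zero
          (mem_monics.1 (Finset.mem_filter.1 hf).1).1.ne_zero).symm
    · rw [mul_zero]
      refine Finset.sum_eq_zero fun f hf => ?_
      obtain ⟨hf, -, hdvd⟩ := Finset.mem_filter.1 hf
      obtain ⟨hf1, hf2⟩ := mem_monics.1 hf
      exact (hn (hf2 ▸ natDegree_le_of_dvd (not_not.1 hdvd) hf1.ne_zero)).elim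

theorem primeToSeries_empty_mul_prod {χ : F[X] → R}
    (hχ : ∀ f g, f ≠ 0 → g ≠ 0 → χ (f * g) = χ f * χ g) (s : Finset (Place F)) :
    primeToSeries χ ∅ *
      ∏ p ∈ s, (1 - PowerSeries.C (χ p.1) * PowerSeries.X ^ p.1.natDegree) =
      primeToSeries χ s := by
  classical
  induction s using Finset.induction_on with
  | empty => simp
  | insert p s hp ih =>
    rw [Finset.prod_insert hp, mul_left_comm, ih, mul_comm, primeToSeries_mul hχ hp]

theorem coeff_primeToSeries {χ : F[X] → R} (h1 : χ 1 = 1) {D n : ℕ} (hn : n ≤ D)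
    {s : Finset (Place F)} (hs : ∀ p : Place F, p.1.natDegree ≤ D → p ∈ s) :
    PowerSeries.coeff n (primeToSeries χ s) = if n = 0 then 1 else 0 := by
  classical
  rw [primeToSeries, PowerSeries.coeff_mk]
  split_ifs with h0
  · subst h0
    rw [Finset.sum_eq_single 1]
    · exact h1
    · intro f hf hf1
      obtain ⟨hf2, hf3⟩ := mem_monics.1 (Finset.mem_filter.1 hf).1
      exact (hf1 (hf2.natDegree_eq_zero.1 hf3)).elim
    · intro h
      refine (h (Finset.mem_filter.2 ⟨mem_monics.2 ⟨monic_one, natDegree_one⟩, ?_⟩)).elim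
      exact fun p _ hp => p.2.2.not_isUnit (isUnit_of_dvd_one hp)
  · refine Finset.sum_eq_zero fun f hf => ?_
    obtain ⟨hf, hfs⟩ := Finset.mem_filter.1 hf
    obtain ⟨hf1, hf2⟩ := mem_monics.1 hf
    have hunit : ¬ IsUnit f := fun h => h0 (hf2 ▸ natDegree_eq_zero_of_isUnit h)
    obtain ⟨g, hg1, hg2, hgf⟩ := exists_monic_irreducible_factor f hunit
    refine (hfs ⟨g, hg1, hg2⟩ (hs _ ?_) hgf).elim
    exact (natDegree_le_of_dvd hgf hf1.ne_zero).trans (hf2.trans_le hn)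

theorem finite_places_natDegree_le (D : ℕ) : {p : Place F | p.1.natDegree ≤ D}.Finite := by
  classical
  refine Set.Finite.of_finite_image (f := Subtype.val) ?_ Subtype.val_injective.injOn
  refine ((Finset.range (D + 1)).biUnion fun n => monics F n).finite_toSet.subset ?_
  rintro _ ⟨p, hp, rfl⟩
  simp only [Finset.coe_biUnion, Set.mem_iUnion]
  exact ⟨_, by simpa [Nat.lt_succ_iff] using hp, mem_monics.2 ⟨p.2.1, rfl⟩⟩

/-- The Euler product of a multiplicative function. A set of places which contains all those of
degree at most `D` gives the right coefficient of `U^D`. -/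
theorem coeff_prod_of_mul_eq_one {χ : F[X] → R} (h1 : χ 1 = 1)
    (hχ : ∀ f g, f ≠ 0 → g ≠ 0 → χ (f * g) = χ f * χ g) {ℓ : Place F → PowerSeries R}
    (hℓ : ∀ p : Place F,
      (1 - PowerSeries.C (χ p.1) * PowerSeries.X ^ p.1.natDegree) * ℓ p = 1)
    {D : ℕ} {s : Finset (Place F)} (hs : ∀ p : Place F, p.1.natDegree ≤ D → p ∈ s) :
    PowerSeries.coeff D (∏ p ∈ s, ℓ p) = ∑ f ∈ monics F D, χ f := by
  have hZ : PowerSeries.coeff D (primeToSeries χ ∅) = ∑ f ∈ monics F D, χ f := by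
    simp [primeToSeries]
  have hprod : primeToSeries χ ∅ = primeToSeries χ s * ∏ p ∈ s, ℓ p := by
    rw [← primeToSeries_empty_mul_prod hχ s, mul_assoc, ← Finset.prod_mul_distrib,
      Finset.prod_congr rfl fun p _ => hℓ p, Finset.prod_const_one, mul_one]
  rw [← hZ, hprod, PowerSeries.coeff_mul, Finset.sum_eq_single (0, D)]
  · rw [coeff_primeToSeries h1 (Nat.zero_le D) hs, if_pos rfl, one_mul]
  · rintro ⟨i, j⟩ hij hne
    have hij : i + j = D := by simpa using hij
    rw [coeff_primeToSeries h1 (by omega : i ≤ D) hs, if_neg, zero_mul]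
    rintro rfl
    exact hne (by simp_all)
  · simp

end EulerProduct

/-! ### Frobenius conjugates -/

section Conjugates

variable {F : Type*} [Field F] [Fintype F] {K : Type*} [Field K] [Algebra F K]

/-- The roots of an irreducible polynomial over a finite field are the Frobenius conjugates of one
of them. -/
theorem roots_map_of_irreducible {p : F[X]} (hp : Irreducible p) {α : K} (hα : aeval α p = 0) :
    (p.map (algebraMap F K)).roots =
      (Multiset.range p.natDegree).map fun i => α ^ Fintype.card F ^ i := by
  have hp0 : p.map (algebraMap F K) ≠ 0 :=
    (Polynomial.map_ne_zero_iff (algebraMap F K).injective).2 hp.ne_zero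
  have hfrob (i : ℕ) (x : K) : ((FiniteField.frobeniusAlgHom F K)^[i]) x
      = x ^ Fintype.card F ^ i := by
    rw [FiniteField.coe_frobeniusAlgHom, pow_iterate]
  have hinj (i : ℕ) : Function.Injective fun x : K => x ^ Fintype.card F ^ i := by
    simp_rw [← hfrob]
    exact (FiniteField.frobeniusAlgHom F K).injective.iterate i
  have hroot (i : ℕ) : aeval (α ^ Fintype.card F ^ i) p = 0 := by
    induction i with
    | zero => simpa using hα
    | succ i ih =>
      have := aeval_algHom_apply (FiniteField.frobeniusAlgHom F K) (α ^ Fintype.card F ^ i) p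
      simp only [ih, map_zero, FiniteField.coe_frobeniusAlgHom] at this
      rw [← pow_mul, ← pow_succ] at this
      exact this
  have hlt : ∀ i j, i < j → j < p.natDegree →
      α ^ Fintype.card F ^ i ≠ α ^ Fintype.card F ^ j := by
    intro i j hij hj h
    obtain ⟨m, rfl⟩ := Nat.exists_eq_add_of_lt hij
    have h1 : α = α ^ Fintype.card F ^ (m + 1) := by
      refine hinj i ?_
      simp only
      rw [h, ← pow_mul, ← pow_add]
      congr 2
      ring
    have h2 : p ∣ X ^ (Nat.card F) ^ (m + 1) - X := by
      refine (Dvd.intro _ (minpoly.eq_of_irreducible hp hα)).trans (minpoly.dvd F α ?_)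
      rw [Nat.card_eq_fintype_card, map_sub, map_pow, aeval_X, ← h1, sub_self]
    have h3 := hp.natDegree_dvd_of_dvd_X_pow_card_pow_sub_X h2
    have := Nat.le_of_dvd (Nat.succ_pos m) h3
    omega
  symm
  refine Multiset.eq_of_le_of_card_le ?_ ?_
  · refine (Multiset.le_iff_subset ?_).2 ?_
    · refine Multiset.Nodup.map_on ?_ (Multiset.nodup_range _)
      intro i hi j hj h
      rw [Multiset.mem_range] at hi hj
      rcases lt_trichotomy i j with hij | hij | hij
      · exact (hlt i j hij hj h).elim
      · exact hij
      · exact (hlt j i hij hi h.symm).elim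
    · intro x hx
      obtain ⟨i, -, rfl⟩ := Multiset.mem_map.1 hx
      rw [mem_roots hp0, IsRoot, eval_map_algebraMap, hroot]
  · rw [Multiset.card_map, Multiset.card_range]
    exact (card_roots' _).trans natDegree_map_le

end Conjugates

/-! ### The polynomial of the twisted Carlitz module -/

section CarlitzPolynomial

variable {F : Type*} [Field F]

/-- The polynomial `P(θ) (T - θ)^n`, in the variable `θ` over `A[T]`. -/
noncomputable def carlitzPoly (A : Type*) [CommRing A] [Algebra F A] (P : F[X]) (n : ℕ) : A[X][X] :=
  P.map (algebraMap F A[X]) * (C X - X) ^ n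

theorem natDegree_carlitzPoly_le (A : Type*) [CommRing A] [Algebra F A] (P : F[X]) (n : ℕ) :
    (carlitzPoly A P n).natDegree ≤ P.natDegree + n := by
  refine natDegree_mul_le.trans (add_le_add natDegree_map_le (natDegree_pow_le.trans ?_))
  refine (Nat.mul_le_mul_left n (natDegree_sub_le _ _)).trans ?_
  rw [natDegree_C]
  exact (Nat.mul_le_mul_left n (max_le (Nat.zero_le 1) natDegree_X_le)).trans (mul_one n).le

theorem carlitzPoly_map (A : Type*) [CommRing A] [Algebra F A] (P : F[X]) (n : ℕ) :
    (carlitzPoly F P n).map (mapRingHom (algebraMap F A)) = carlitzPoly A P n := by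
  have h : (mapRingHom (algebraMap F A)).comp (algebraMap F F[X]) = algebraMap F A[X] := by
    ext x
    simp [algebraMap_eq, Polynomial.algebraMap_apply]
  rw [carlitzPoly, Polynomial.map_mul, Polynomial.map_map, h, carlitzPoly]
  simp

theorem eval_carlitzPoly {K : Type*} [Field K] [Algebra F K] (P : F[X])
    (n : ℕ) (a : K) :
    (carlitzPoly K P n).eval (algebraMap K K[X] a) = C (aeval a P) * (X - C a) ^ n := by
  rw [carlitzPoly, eval_mul, eval_pow, eval_sub, eval_C, eval_X, eval_map_algebraMap,
    aeval_algebraMap_apply, algebraMap_eq]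

theorem reduce_algebraMap (p : Place F) (f : F[X]) :
    reduce p (algebraMap F[X] (RatFunc F) f) = AdjoinRoot.mk p.1 f := by
  rw [reduce, RatFunc.num_algebraMap, RatFunc.denom_algebraMap, map_one, div_one]

theorem reducePoly_map_algebraMap (p : Place F) (g : F[X][X]) :
    reducePoly p (g.map (algebraMap F[X] (RatFunc F))) = g.map (AdjoinRoot.mk p.1) := by
  ext s
  simp only [reducePoly, finsetSum_coeff, coeff_monomial, coeff_map, reduce_algebraMap,
    Finset.sum_ite_eq', mem_support_iff]
  split_ifs with h
  · rfl
  · rw [mem_support_iff, not_not, coeff_map] at h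
    rw [(map_eq_zero_iff _ (RatFunc.algebraMap_injective F)).1 h, map_zero]

end CarlitzPolynomial

/-! ### Base change of the determinant -/

section BaseChange

theorem cartierMatrix_map {R S : Type*} [CommRing R] [CommRing S] (f : R →+* S) (Q : R[X])
    (q k : ℕ) : (cartierMatrix Q q k).map f = cartierMatrix (Q.map f) q k := by
  ext i j
  rw [Matrix.map_apply, cartierMatrix, cartierMatrix, Matrix.of_apply, Matrix.of_apply,
    ← coeff_map, Polynomial.map_mul, Polynomial.map_pow, map_X]

theorem charpolyRev_map {R S ι : Type*} [CommRing R] [CommRing S] [Fintype ι] [DecidableEq ι]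
    (f : R →+* S) (M : Matrix ι ι R) : M.charpolyRev.map f = (M.map f).charpolyRev := by
  ext d
  rw [coeff_map, coeff_charpolyRev, coeff_charpolyRev, map_mul, map_pow, map_neg, map_one, map_sum]
  simp_rw [RingHom.map_det]
  rfl

end BaseChange

/-! ### Local factors -/

section LocalFactors

variable {F : Type*} [Field F] [Fintype F]

theorem frakM_eq_cartierMatrix (P : F[X]) (n k : ℕ) :
    frakM P n k = cartierMatrix (carlitzPoly F P n) (Fintype.card F) k := by
  ext1 i j
  rw [frakM, cartierMatrix, Matrix.of_apply, Matrix.of_apply, carlitzPoly,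
    sub_eq_neg_add (C X : F[X][X]), add_pow,
    Finset.mul_sum, Finset.mul_sum, finsetSum_coeff]
  refine Finset.sum_congr rfl fun l _ => ?_
  have h : (X : F[X][X]) ^ ((j : ℕ) + 1) * (P.map (algebraMap F F[X]) *
      ((-X : F[X][X]) ^ l * C X ^ (n - l) * (n.choose l : F[X][X]))) =
      C (X ^ (n - l) * (-1) ^ l * (n.choose l : F[X])) *
        (X ^ ((j : ℕ) + 1 + l) * P.map (algebraMap F F[X])) := by
    rw [neg_pow (X : F[X][X]), pow_add (X : F[X][X]) (_ + 1) l]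
    simp only [C_mul, C_pow, map_neg, map_one, map_natCast]
    ring
  rw [h, coeff_C_mul, coeff_X_pow_mul', coeff_map, coeffInt]
  congr 1
  have hcast : ((i : ℤ) + 1) * Fintype.card F - ((j : ℤ) + 1) - l =
      ((Fintype.card F * ((i : ℕ) + 1) : ℕ) : ℤ) - ((j : ℕ) + 1 + l : ℕ) := by
    push_cast
    ring
  rw [hcast]
  generalize Fintype.card F * ((i : ℕ) + 1) = a
  generalize (j : ℕ) + 1 + l = b
  by_cases hab : b ≤ a
  · rw [if_pos hab, if_pos (by omega), algebraMap_eq]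
    congr 2
    omega
  · rw [if_neg hab, if_neg (by omega), map_zero]

variable {K : Type*} [Field K] [Algebra F K]

theorem frob_iterate_eval_carlitzPoly (P : F[X]) (n : ℕ) (a : K) (i : ℕ) :
    (frob F K)^[i] ((carlitzPoly K P n).eval (algebraMap K K[X] a)) =
      (carlitzPoly K P n).eval (algebraMap K K[X] (a ^ Fintype.card F ^ i)) := by
  induction i with
  | zero => simp
  | succ i ih =>
    have h := aeval_algHom_apply (FiniteField.frobeniusAlgHom F K) (a ^ Fintype.card F ^ i) P
    simp only [FiniteField.coe_frobeniusAlgHom] at h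
    rw [Function.iterate_succ_apply', ih, eval_carlitzPoly, eval_carlitzPoly, pow_succ, pow_mul, h]
    simp only [frob, coe_mapRingHom, Polynomial.map_mul, Polynomial.map_pow, Polynomial.map_sub,
      map_X, map_C]
    rfl

theorem twistProd_unit {A : Type*} [CommRing A] [Algebra F A] (Q : Matrix Unit Unit A[X]) (d : ℕ) :
    twistProd F Q d () () = ∏ i ∈ Finset.range d, (frob F A)^[i] (Q () ()) := by
  induction d with
  | zero => simp [twistProd]
  | succ d ih =>
    rw [twistProd, Matrix.mul_apply, Finset.univ_unique, Finset.sum_singleton,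
      Finset.prod_range_succ, mul_comm]
    exact congrArg (· * _) ih

theorem twistedCarlitzMatrix_apply (P : F[X]) (n : ℕ) (i j : Unit) :
    twistedCarlitzMatrix P n i j =
      (C P * (X - C X) ^ n : F[X][X]).map (algebraMap F[X] (RatFunc F)) := by
  simp [twistedCarlitzMatrix, tauMatrix, twistedCarlitzTau, RatFunc.algebraMap_X]

theorem twistedCarlitzMatrix_isGoodAt (P : F[X]) (n : ℕ) (p : Place F) :
    IsGoodAt (twistedCarlitzMatrix P n) p := by
  intro i j s
  rw [twistedCarlitzMatrix_apply, coeff_map, IsIntegerAt, RatFunc.denom_algebraMap]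
  exact fun h => p.2.2.not_isUnit (isUnit_of_dvd_one h)

theorem localPoly_twistedCarlitzMatrix_map [IsAlgClosed K] (P : F[X]) (n : ℕ) (p : Place F) :
    (localPoly (twistedCarlitzMatrix P n) p).map (mapRingHom (algebraMap F K)) =
      1 - C (rootProd K (carlitzPoly K P n) p.1) * X ^ p.1.natDegree := by
  obtain ⟨α, hα⟩ := IsAlgClosed.exists_aeval_eq_zero K p.1 (degree_pos_of_irreducible p.2.2).ne'
  let ι : ResidueField p →ₐ[F] K := AdjoinRoot.liftAlgHom p.1 (Algebra.ofId F K) α hα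
  have hι (f : F[X]) : ι (AdjoinRoot.mk p.1 f) = aeval α f := AdjoinRoot.liftAlgHom_mk ..
  have hspec : (localPoly (twistedCarlitzMatrix P n) p).map
      (mapRingHom (algebraMap F (ResidueField p))) =
        localDet F ((twistedCarlitzMatrix P n).map (reducePoly p)) p.1.natDegree :=
    (exists_localDet _ p.2.2.natDegree_pos (residueField_pow p)).choose_spec
  have hcomp : (mapRingHom (ι : ResidueField p →+* K)).comp
      (mapRingHom (algebraMap F (ResidueField p))) = mapRingHom (algebraMap F K) := by
    rw [mapRingHom_comp, AlgHom.comp_algebraMap]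
  have hfrob (i : ℕ) (a : (ResidueField p)[X]) :
      ((frob F (ResidueField p))^[i] a).map (ι : ResidueField p →+* K) =
        (frob F K)^[i] (a.map (ι : ResidueField p →+* K)) := by
    ext s
    simp [frob_iterate]
  have hQ : (reducePoly p (twistedCarlitzMatrix P n () ())).map (ι : ResidueField p →+* K) =
      (carlitzPoly K P n).eval (algebraMap K K[X] α) := by
    rw [twistedCarlitzMatrix_apply, reducePoly_map_algebraMap, eval_carlitzPoly]
    simp only [Polynomial.map_mul, Polynomial.map_pow, Polynomial.map_sub, map_X, map_C,
      RingHom.coe_coe, hι, aeval_X]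
  rw [← hcomp, ← Polynomial.map_map, hspec, localDet, Matrix.det_unique]
  have htwist : mapRingHom (ι : ResidueField p →+* K)
      (twistProd F ((twistedCarlitzMatrix P n).map (reducePoly p)) p.1.natDegree () ()) =
        rootProd K (carlitzPoly K P n) p.1 := by
    rw [twistProd_unit, map_prod, rootProd, roots_map_of_irreducible p.2.2 hα, Multiset.map_map,
      ← Finset.range_val, ← Finset.prod_eq_multiset_prod]
    refine Finset.prod_congr rfl fun i _ => ?_
    rw [coe_mapRingHom, hfrob, Matrix.map_apply, hQ, frob_iterate_eval_carlitzPoly]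
    rfl
  rw [Matrix.sub_apply, Matrix.one_apply_eq, Matrix.smul_apply, Matrix.map_apply, smul_eq_mul,
    Polynomial.map_sub, Polynomial.map_one, Polynomial.map_mul, Polynomial.map_pow, map_X, map_C,
    mul_comm, ← htwist]

end LocalFactors

/-! ### The Euler product of the twisted Carlitz module -/

section LFunction

variable {F : Type*} [Field F] [Fintype F]

theorem coeff_prod_localFactor (P : F[X]) (n : ℕ) {k : ℕ}
    (hk : P.natDegree + n ≤ (Fintype.card F - 1) * k) {D : ℕ} {s : Finset (Place F)}
    (hs : ∀ p : Place F, p.1.natDegree ≤ D → p ∈ s) :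
    PowerSeries.coeff D (∏ p ∈ s, localFactor (twistedCarlitzMatrix P n) p) =
      (frakDet P n k).coeff D := by
  -- All identities are checked over `K[T]`, where the roots live, and descend by injectivity.
  let K := AlgebraicClosure F
  let φ : F[X] →+* K[X] := mapRingHom (algebraMap F K)
  have hφ : Function.Injective φ := map_injective _ (algebraMap F K).injective
  have hlocal (p : Place F) := localPoly_twistedCarlitzMatrix_map (K := K) P n p
  have hconst (p : Place F) : PowerSeries.constantCoeff
      (localPoly (twistedCarlitzMatrix P n) p : PowerSeries F[X]) = ((1 : F[X]ˣ) : F[X]) := by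
    refine hφ ?_
    have := congrArg (fun f => coeff f 0) (hlocal p)
    rw [coeff_map] at this
    rw [← PowerSeries.coeff_zero_eq_constantCoeff_apply, coeff_coe, Units.val_one, map_one]
    refine this.trans ?_
    rw [coeff_sub, coeff_one_zero, coeff_C_mul, coeff_X_pow, if_neg p.2.2.natDegree_pos.ne,
      mul_zero, sub_zero]
  have hfactor (p : Place F) :
      (1 - PowerSeries.C (rootProd K (carlitzPoly K P n) p.1) *
        PowerSeries.X ^ p.1.natDegree) *
        PowerSeries.map φ (localFactor (twistedCarlitzMatrix P n) p) = 1 := by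
    have h1 : ((1 - C (rootProd K (carlitzPoly K P n) p.1) * X ^ p.1.natDegree : K[X][X]) :
        PowerSeries K[X]) = 1 - PowerSeries.C (rootProd K (carlitzPoly K P n) p.1) *
        PowerSeries.X ^ p.1.natDegree := by
      simp
    rw [← h1, ← hlocal p, polynomial_map_coe, ← map_mul, localFactor,
      PowerSeries.mul_invOfUnit _ _ (hconst p), map_one]
  have hprod := coeff_prod_of_mul_eq_one (rootProd_one K (carlitzPoly K P n))
    (fun f g hf hg => rootProd_mul K (carlitzPoly K P n) hf hg) hfactor hs
  refine hφ ?_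
  rw [← map_prod, PowerSeries.coeff_map,
    sum_rootProd K ((natDegree_carlitzPoly_le K P n).trans hk)] at hprod
  rw [hprod, ← carlitzPoly_map, ← cartierMatrix_map, ← frakM_eq_cartierMatrix, ← charpolyRev_map,
    coeff_map]
  rfl

theorem hasProd_localFactor (P : F[X]) (n : ℕ) {k : ℕ}
    (hk : P.natDegree + n ≤ (Fintype.card F - 1) * k) :
    letI := seriesTopology F
    HasProd (fun p : {p : Place F // IsGoodAt (twistedCarlitzMatrix P n) p} =>
      localFactor (twistedCarlitzMatrix P n) p.1) (frakDet P n k : PowerSeries F[X]) := by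
  let : TopologicalSpace F[X] := ⊥
  let := seriesTopology F
  rw [← (Equiv.subtypeUnivEquiv (twistedCarlitzMatrix_isGoodAt P n)).symm.hasProd_iff]
  refine (PowerSeries.WithPiTopology.tendsto_iff_coeff_tendsto _ _ _ _).2 fun D => ?_
  refine tendsto_const_nhds.congr' ?_
  rw [SummationFilter.unconditional_filter]
  filter_upwards [Filter.eventually_ge_atTop (finite_places_natDegree_le D).toFinset] with s hs
  rw [coeff_coe]
  exact (coeff_prod_localFactor P n hk fun p hp => hs (by simpa using hp)).symm

end LFunction

end TMotive

theorem proposition3p3 {F : Type*} [Field F] [Fintype F] (P : F[X]) (hP : P ≠ 0) (n k : ℕ)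
    (hk : ((P.natDegree : ℚ) + n) / ((Fintype.card F : ℚ) - 1) ≤ k) :
    (∀ p : TMotive.Place F, TMotive.IsGoodAt (TMotive.twistedCarlitzMatrix P n) p) ∧
      TMotive.EulerProductConverges (TMotive.twistedCarlitzMatrix P n) ∧
      TMotive.LFunction (TMotive.twistedCarlitzMatrix P n) =
        (TMotive.frakDet P n k : PowerSeries F[X]) := by
  have hq : 1 < Fintype.card F := Fintype.one_lt_card
  have hk' : P.natDegree + n ≤ (Fintype.card F - 1) * k := by
    rw [div_le_iff₀ (by rw [sub_pos]; exact_mod_cast hq)] at hk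
    have : ((P.natDegree + n : ℕ) : ℚ) ≤ ((Fintype.card F - 1) * k : ℕ) := by
      push_cast [Nat.cast_sub hq.le]
      linarith
    exact_mod_cast this
  have h := TMotive.hasProd_localFactor P n hk'
  refine ⟨TMotive.twistedCarlitzMatrix_isGoodAt P n, ?_, ?_⟩
  · let := TMotive.seriesTopology F
    exact h.multipliable
  · let : TopologicalSpace F[X] := ⊥
    have : DiscreteTopology F[X] := ⟨rfl⟩
    let := TMotive.seriesTopology F
    have : T2Space (PowerSeries F[X]) := PowerSeries.WithPiTopology.instT2Space F[X]
    exact h.tprod_eq
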